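/- Let $K$ be a field of characteristic zero, let $m\ge 2$ be an integer, and let $A=K+\sum_{i\ge m}Kx^i$, a subalgebra of the polynomial algebra $K[x]$. Let $\mathcal D(A)\subseteq \mathrm{End}_K(A)$ be the ring of ($K$-linear) differential operators on $A$, that is, $\mathcal D(A)=\bigcup_{n\ge 0}\mathcal D_n(A)$, where $\mathcal D_0(A)$ consists of all $f\in\mathrm{End}_K(A)$ that commute with the multiplications by elements of $A$, and $\mathcal D_{n+1}(A)=\{f\in \mathrm{End}_K(A) : fa-af\in\mathcal D_n(A)\text{ for all }a\in A\}$. Then for every nonzero left ideal $I$ of $\mathcal D(A)$, the left $\mathcal D(A)$-module $\mathcal D(A)/I$ has finite length. -/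

import Mathlib

open Polynomial

/-- `IsDiffOp R A n f`: the `R`-linear endomorphism `f` of the commutative `R`-algebra `A` is a
differential operator of order at most `n` (in the sense of Grothendieck): the operators of order
at most `0` are those that commute with all multiplications by elements of `A`, and `f` has order
at most `n + 1` if all commutators `[f, a]`, `a ∈ A`, have order at most `n`. -/
def IsDiffOp (R A : Type*) [CommRing R] [CommRing A] [Algebra R A] :
    ℕ → Module.End R A → Prop
  | 0, f => ∀ a : A, f * LinearMap.mulLeft R a - LinearMap.mulLeft R a * f = 0
  | n + 1, f => ∀ a : A,
      IsDiffOp R A n (f * LinearMap.mulLeft R a - LinearMap.mulLeft R a * f)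

namespace IsDiffOp

variable {R A : Type*} [CommRing R] [CommRing A] [Algebra R A]

theorem zero (n : ℕ) : IsDiffOp R A n 0 := by
  induction n with
  | zero => intro a; simp
  | succ n ih => intro a; simpa using ih

theorem succ {n : ℕ} {f : Module.End R A} (hf : IsDiffOp R A n f) : IsDiffOp R A (n + 1) f := by
  induction n generalizing f with
  | zero => intro a; rw [hf a]; exact zero 0
  | succ n ih => intro a; exact ih (hf a)

theorem mono {n k : ℕ} (h : n ≤ k) {f : Module.End R A} (hf : IsDiffOp R A n f) :
    IsDiffOp R A k f := by
  induction h with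
  | refl => exact hf
  | step _ ih => exact ih.succ

theorem add {n : ℕ} {f g : Module.End R A} (hf : IsDiffOp R A n f) (hg : IsDiffOp R A n g) :
    IsDiffOp R A n (f + g) := by
  induction n generalizing f g with
  | zero =>
    intro a
    have h := congrArg₂ (· + ·) (hf a) (hg a)
    simp only [add_zero] at h
    rw [← h]
    noncomm_ring
  | succ n ih =>
    intro a
    have h := ih (hf a) (hg a)
    convert h using 1
    noncomm_ring

/-- The composition of operators of orders at most `n` and `k` has order at most `n + k`. -/
theorem mul {n k : ℕ} {f g : Module.End R A} (hf : IsDiffOp R A n f) (hg : IsDiffOp R A k g) :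
    IsDiffOp R A (n + k) (f * g) := by
  have key : ∀ (f g : Module.End R A) (a : A),
      f * g * LinearMap.mulLeft R a - LinearMap.mulLeft R a * (f * g) =
        f * (g * LinearMap.mulLeft R a - LinearMap.mulLeft R a * g) +
        (f * LinearMap.mulLeft R a - LinearMap.mulLeft R a * f) * g := by
    intro f g a
    rw [mul_sub, sub_mul, mul_assoc, mul_assoc, mul_assoc]
    abel
  induction hs : n + k generalizing n k f g with
  | zero =>
    obtain ⟨rfl, rfl⟩ : n = 0 ∧ k = 0 := by omega
    intro a
    rw [key, hf a, hg a]
    simp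
  | succ s ih =>
    intro a
    rw [key]
    refine add ?_ ?_
    · cases k with
      | zero => rw [hg a, mul_zero]; exact zero s
      | succ k => exact ih hf (hg a) (by omega)
    · cases n with
      | zero => rw [hf a, zero_mul]; exact zero s
      | succ n => exact ih (hf a) hg (by omega)

end IsDiffOp

/-- The ring `𝒟(A)` of `R`-linear differential operators on the commutative `R`-algebra `A`,
as a subalgebra of the algebra of `R`-linear endomorphisms of `A`. -/
def diffOps (R A : Type*) [CommRing R] [CommRing A] [Algebra R A] :
    Subalgebra R (Module.End R A) where
  carrier := {f | ∃ n, IsDiffOp R A n f}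
  mul_mem' := by
    rintro f g ⟨n, hf⟩ ⟨k, hg⟩
    exact ⟨n + k, hf.mul hg⟩
  add_mem' := by
    rintro f g ⟨n, hf⟩ ⟨k, hg⟩
    exact ⟨max n k, (hf.mono (le_max_left n k)).add (hg.mono (le_max_right n k))⟩
  algebraMap_mem' := by
    intro r
    refine ⟨0, fun a => ?_⟩
    rw [Algebra.commutes r (LinearMap.mulLeft R a), sub_self]

/-- The ring `𝒟(A)` of `R`-linear differential operators on `A`, as a type. -/
def DiffOps (R A : Type*) [CommRing R] [CommRing A] [Algebra R A] : Type _ := diffOps R A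

/-- The ring structure on `𝒟(A)`: that of a subalgebra of `Module.End R A`. -/
instance DiffOps.instRing (R A : Type*) [CommRing R] [CommRing A] [Algebra R A] :
    Ring (DiffOps R A) :=
  inferInstanceAs (Ring (diffOps R A))

/-- The `R`-algebra structure on `𝒟(A)`. -/
instance DiffOps.instAlgebra (R A : Type*) [CommRing R] [CommRing A] [Algebra R A] :
    Algebra R (DiffOps R A) :=
  inferInstanceAs (Algebra R (diffOps R A))

/-- The inclusion of `𝒟(A)` into the algebra of linear endomorphisms of `A`. -/
def DiffOps.val (R A : Type*) [CommRing R] [CommRing A] [Algebra R A] :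
    DiffOps R A →ₐ[R] Module.End R A :=
  (diffOps R A).val

theorem DiffOps.val_injective (R A : Type*) [CommRing R] [CommRing A] [Algebra R A] :
    Function.Injective (DiffOps.val R A) :=
  Subtype.val_injective

theorem DiffOps.range_val (R A : Type*) [CommRing R] [CommRing A] [Algebra R A] :
    (DiffOps.val R A).range = diffOps R A :=
  (diffOps R A).range_val

/-- The generalized cusp algebra `A(m) = K + ∑_{i ≥ m} K x^i ⊆ K[x]`, that is, the polynomials
without monomials `x^i` for `0 < i < m`. -/
def cuspAlgebra (K : Type*) [CommRing K] (m : ℕ) : Subalgebra K K[X] where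
  carrier := {p | ∀ i, 0 < i → i < m → p.coeff i = 0}
  mul_mem' := by
    intro p q hp hq i hi him
    rw [coeff_mul]
    refine Finset.sum_eq_zero fun x hx => ?_
    have hx' : x.1 + x.2 = i := Finset.HasAntidiagonal.mem_antidiagonal.mp hx
    rcases Nat.eq_zero_or_pos x.1 with h | h
    · rw [hq x.2 (by omega) (by omega), mul_zero]
    · rw [hp x.1 h (by omega), zero_mul]
  add_mem' := by
    intro p q hp hq i hi him
    rw [coeff_add, hp i hi him, hq i hi him, add_zero]
  algebraMap_mem' := by
    intro r i hi _
    rw [Polynomial.algebraMap_apply, coeff_C, if_neg hi.ne']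

/-- As a `K`-module, `A(m) = K + ∑_{i ≥ m} K x^i`. -/
theorem cuspAlgebra_toSubmodule (K : Type*) [CommRing K] (m : ℕ) :
    Subalgebra.toSubmodule (cuspAlgebra K m) =
      Submodule.span K {1} ⊔ ⨆ i ≥ m, Submodule.span K {(X : K[X]) ^ i} := by
  apply le_antisymm
  · intro p hp
    rw [p.as_sum_support]
    refine Submodule.sum_mem _ fun i hi => ?_
    rw [← C_mul_X_pow_eq_monomial, ← smul_eq_C_mul]
    refine Submodule.smul_mem _ _ ?_
    rcases Nat.eq_zero_or_pos i with rfl | h0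
    · rw [pow_zero]
      exact Submodule.mem_sup_left (Submodule.mem_span_singleton_self _)
    · have him : m ≤ i := by
        by_contra h
        exact (mem_support_iff.mp hi) (hp i h0 (by omega))
      refine Submodule.mem_sup_right ?_
      exact Submodule.mem_iSup_of_mem i
        (Submodule.mem_iSup_of_mem him (Submodule.mem_span_singleton_self _))
  · refine sup_le ?_ (iSup₂_le fun i hi => ?_)
    · rw [Submodule.span_singleton_le_iff_mem]
      exact (cuspAlgebra K m).one_mem
    · rw [Submodule.span_singleton_le_iff_mem]
      intro j _ hjm
      have hi' : m ≤ i := hi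
      rw [coeff_X_pow, if_neg (by omega)]

/-! An operator on `A` splits into finitely many components `x ^ j ↦ p_k(j) x ^ (j + k)`, one for
each weight `k`, with `p_k` a polynomial and `j` in `{0} ∪ [m, ∞)` (`symbol`). So `𝒟(A)` is close
enough to the Weyl algebra for Bernstein's dimension count. Let `F i` consist of the operators with
all weights in `[-i, i]` and all `p_k` of degree at most `i`. Then `dim F i` is at least quadratic
in `i`, and its increments are at most linear.

The key is a quantitative form of simplicity (`Annihilates.mem`): if `0 ≠ d ∈ F i` and `d * F (a i +
b) * u ⊆ J`, then `u ∈ J`, with `a`, `b` independent of `J` and `u`. Commutators with the Euler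
operator isolate one weight of `d`, commutators with `x ^ m` reduce its polynomial to a constant,
and an operator of opposite weight turns the resulting monomial into `1`.

Hence `F i` embeds into the linear maps between two orbits of `u` modulo `J`, and the orbit of any
`u ∉ J` grows at least linearly with a uniform slope (`exists_le_finrank_orbit`). On the other hand,
if `0 ≠ x ∈ I ∩ F q`, then `F (n - q) * x ⊆ I ∩ F n` has codimension in `F n` at most linear in `n`,
as `𝒟(A)` is a domain. Each step of a chain of left ideals above `I` uses up a fixed share of this
linear growth, so the length of chains is bounded. -/

/-- The conditions on a filtration `F` of an algebra `D` by finite-dimensional subspaces under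
which a counting argument bounds the length of the proper cyclic left `D`-modules. -/
structure IsBernsteinFiltration {K D : Type*} [Field K] [Ring D] [Algebra K D]
    (F : ℕ → Submodule K D) : Prop where
  mono : Monotone F
  exhaustive : ∀ d, ∃ i, d ∈ F i
  mul_mem : ∀ {i j d e}, d ∈ F i → e ∈ F j → d * e ∈ F (i + j)
  finite : ∀ i, FiniteDimensional K (F i)
  growth_le : ∀ k, ∃ C, ∀ i, Module.finrank K (F (i + k)) ≤ Module.finrank K (F i) + C * (i + 1)
  le_growth : ∃ s, ∀ i, (i + 1) ^ 2 ≤ Module.finrank K (F (i + s))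
  -- `a` and `b` are chosen before `J` and `u`, so that one slope serves every step of a chain of
  -- ideals.
  faithful : ∃ a b, ∀ i, ∀ d ∈ F i, d ≠ 0 → ∀ (J : Ideal D) (u : D),
    (∀ e ∈ F (a * i + b), d * e * u ∈ J) → u ∈ J

/-! ### Bernstein's inequality and the bound on the length -/

namespace IsBernsteinFiltration

variable {K D : Type*} [Field K] [Ring D] [Algebra K D] {F : ℕ → Submodule K D}

/-- The image of `F i * u` in `D ⧸ J`. -/
def orbit (F : ℕ → Submodule K D) (J : Ideal D) (u : D) (i : ℕ) :
    Submodule K (D ⧸ J.restrictScalars K) :=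
  (F i).map ((J.restrictScalars K).mkQ ∘ₗ LinearMap.mulRight K u)

/-- Left multiplication embeds `F i` into the linear maps from the orbit at `N` to the orbit at `i +
N`; `h` is injectivity. The maps are recorded by their values on a basis with representatives `e t *
u`. -/
theorem finrank_le_mul_orbit (hF : IsBernsteinFiltration F) {J : Ideal D} {u : D} {i N : ℕ}
    (h : ∀ d ∈ F i, (∀ e ∈ F N, d * e * u ∈ J) → d = 0) :
    Module.finrank K (F i) ≤
      Module.finrank K (orbit F J u N) * Module.finrank K (orbit F J u (i + N)) := by
  have := hF.finite
  have fin : ∀ n, FiniteDimensional K (orbit F J u n) := fun n => by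
    unfold orbit; infer_instance
  let b := Module.finBasis K (orbit F J u N)
  choose e he using fun t => Submodule.mem_map.mp (b t).2
  let φ : F i →ₗ[K] (Fin (Module.finrank K (orbit F J u N)) → orbit F J u (i + N)) :=
    LinearMap.pi fun t => LinearMap.codRestrict _
      (((J.restrictScalars K).mkQ ∘ₗ LinearMap.mulRight K (e t * u)) ∘ₗ (F i).subtype) (by
        intro d
        refine Submodule.mem_map.mpr ⟨d * e t, hF.mul_mem d.2 (he t).1, ?_⟩
        simp [mul_assoc])
  have hφ : Function.Injective φ := by
    rw [← LinearMap.ker_eq_bot, LinearMap.ker_eq_bot']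
    intro d hd
    have h1 : ∀ t, (d : D) * (e t * u) ∈ J := fun t => by
      have := congrArg Subtype.val (congrFun hd t)
      simpa [φ, Submodule.Quotient.mk_eq_zero, mul_assoc] using this
    refine Subtype.ext (h d d.2 fun x hx => ?_)
    have hxm : (J.restrictScalars K).mkQ (x * u) ∈ orbit F J u N :=
      Submodule.mem_map.mpr ⟨x, hx, rfl⟩
    have hs : ((∑ t, b.repr ⟨_, hxm⟩ t • b t : orbit F J u N) : D ⧸ J.restrictScalars K) =
        (J.restrictScalars K).mkQ (x * u) := congrArg Subtype.val (b.sum_repr ⟨_, hxm⟩)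
    set c := b.repr ⟨_, hxm⟩
    have h2 : x * u - ∑ t, c t • (e t * u) ∈ J.restrictScalars K := by
      rw [← Submodule.Quotient.mk_eq_zero, ← Submodule.mkQ_apply, map_sub, sub_eq_zero, ← hs,
        map_sum, AddSubmonoidClass.coe_finsetSum]
      refine Finset.sum_congr rfl fun t _ => ?_
      rw [Submodule.coe_smul, ← (he t).2, map_smul]
      rfl
    have h3 : (d : D) * (∑ t, c t • (e t * u)) ∈ J := by
      rw [Finset.mul_sum]
      refine Ideal.sum_mem _ fun t _ => ?_
      rw [mul_smul_comm]
      exact (J.restrictScalars K).smul_mem _ (h1 t)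
    have h4 := J.add_mem (J.mul_mem_left d h2) h3
    rwa [← mul_add, sub_add_cancel, ← mul_assoc] at h4
  have := LinearMap.finrank_le_finrank_of_injective hφ
  rwa [Module.finrank_pi_fintype, Finset.sum_const, Finset.card_univ, Fintype.card_fin,
    smul_eq_mul] at this

/-- Bernstein's inequality, with constants that depend on the filtration only. -/
theorem exists_le_finrank_orbit (hF : IsBernsteinFiltration F) :
    ∃ a b, ∀ (J : Ideal D) (u : D), u ∉ J → ∀ i,
      i + 1 ≤ Module.finrank K (orbit F J u (a * i + b)) := by
  obtain ⟨a, b, hab⟩ := hF.faithful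
  obtain ⟨s, hs⟩ := hF.le_growth
  refine ⟨a + 1, (a + 1) * s + b, fun J u hu i => ?_⟩
  have := hF.finite
  have fin : ∀ n, FiniteDimensional K (orbit F J u n) := fun n => by
    unfold orbit; infer_instance
  have h1 := hF.finrank_le_mul_orbit (J := J) (u := u) (i := i + s) (N := a * (i + s) + b)
    fun d hd h => by
      by_contra hd0
      exact hu (hab _ d hd hd0 J u h)
  -- Both orbits lie in the one at level `(a + 1) * i + ((a + 1) * s + b)`, so the square of its
  -- dimension is at least `(i + 1) ^ 2`.
  have e1 : i + s + (a * (i + s) + b) = (a + 1) * i + ((a + 1) * s + b) := by ring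
  rw [e1] at h1
  have h2 : Module.finrank K (orbit F J u (a * (i + s) + b)) ≤
      Module.finrank K (orbit F J u ((a + 1) * i + ((a + 1) * s + b))) :=
    Submodule.finrank_mono (Submodule.map_mono (hF.mono (by rw [← e1]; omega)))
  have h3 := (hs i).trans (h1.trans (Nat.mul_le_mul_right _ h2))
  rw [← sq] at h3
  exact (Nat.pow_le_pow_iff_left two_ne_zero).mp h3

/-- Modulo `J`, the space `J' ∩ F (i + k)` contains the orbit `F i * u`, while `J ∩ F (i + k)` goes
to zero: rank-nullity. -/
theorem finrank_inf_add_orbit_le (hF : IsBernsteinFiltration F) {J J' : Ideal D} (hJ : J ≤ J')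
    {u : D} (hu : u ∈ J') {i k : ℕ} (huk : u ∈ F k) :
    Module.finrank K (J.restrictScalars K ⊓ F (i + k) : Submodule K D) +
        Module.finrank K (orbit F J u i) ≤
      Module.finrank K (J'.restrictScalars K ⊓ F (i + k) : Submodule K D) := by
  have := hF.finite
  let W : Submodule K D := J'.restrictScalars K ⊓ F (i + k)
  have : FiniteDimensional K W := Submodule.finiteDimensional_of_le (inf_le_right : W ≤ F (i + k))
  let φ : W →ₗ[K] D ⧸ J.restrictScalars K := (J.restrictScalars K).mkQ ∘ₗ W.subtype
  have h := LinearMap.finrank_range_add_finrank_ker φ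
  have h1 : orbit F J u i ≤ LinearMap.range φ := by
    rintro _ ⟨d, hd, rfl⟩
    exact ⟨⟨d * u, J'.mul_mem_left d hu, hF.mul_mem hd huk⟩, rfl⟩
  have h2 : Module.finrank K (J.restrictScalars K ⊓ F (i + k) : Submodule K D) ≤
      Module.finrank K (LinearMap.ker φ) := by
    have hle : (J.restrictScalars K ⊓ F (i + k) : Submodule K D) ≤ W :=
      inf_le_inf_right _ hJ
    let ψ : (J.restrictScalars K ⊓ F (i + k) : Submodule K D) →ₗ[K] LinearMap.ker φ :=
      LinearMap.codRestrict _ (Submodule.inclusion hle) fun x => by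
        rw [LinearMap.mem_ker]
        exact (Submodule.Quotient.mk_eq_zero _).mpr x.2.1
    refine LinearMap.finrank_le_finrank_of_injective (f := ψ) fun x y hxy => ?_
    have := congrArg (fun z : LinearMap.ker φ => ((z : W) : D)) hxy
    exact Subtype.ext this
  have h3 := Submodule.finrank_mono h1
  change _ ≤ Module.finrank K W
  omega

theorem isFiniteLength_quotient [NoZeroDivisors D] (hF : IsBernsteinFiltration F) {I : Ideal D}
    (hI : I ≠ ⊥) : IsFiniteLength D (D ⧸ I) := by
  have hfin := hF.finite
  obtain ⟨x, hxI, hx0⟩ := Submodule.exists_mem_ne_zero_of_ne_bot hI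
  obtain ⟨q, hq⟩ := hF.exhaustive x
  obtain ⟨C, hC⟩ := hF.growth_le q
  obtain ⟨a, b, hab⟩ := hF.exists_le_finrank_orbit
  rw [← Module.length_ne_top_iff, Ne, Module.length_eq_top_iff_infiniteDimensionalOrder]
  intro hinf
  -- One step more than the ratio `C * a` of the two linear growth rates allows.
  let p := LTSeries.withLength (Submodule D (D ⧸ I)) (C * a + 1)
  have hp : p.length = C * a + 1 := LTSeries.length_withLength _ _
  let J : ℕ → Ideal D := fun n => (p ⟨min n p.length, by omega⟩).comap I.mkQ
  have hlt : ∀ n < p.length, J n < J (n + 1) := fun n hn => by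
    refine Submodule.comap_strictMono_of_surjective I.mkQ_surjective (p.strictMono ?_)
    rw [Fin.mk_lt_mk]
    omega
  choose! u hu hu' using fun n hn => SetLike.exists_of_lt (hlt n hn)
  choose d hd using fun n => hF.exhaustive (u n)
  let k := q + (Finset.range p.length).sup d
  have hk : ∀ n < p.length, u n ∈ F k := fun n hn =>
    hF.mono ((Finset.le_sup (f := d) (Finset.mem_range.mpr hn)).trans (Nat.le_add_left _ _)) (hd n)
  -- Large enough for the slopes to decide: the chain needs `(C * a + 1) * (i + 1)` dimensions, but
  -- at most `C * (N + 1) = C * a * i + i` are available.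
  let i := C * (b + k + 1)
  let N := a * i + b + k
  let w : ℕ → ℕ := fun n => Module.finrank K ((J n).restrictScalars K ⊓ F N : Submodule K D)
  have hstep : ∀ n ≤ p.length, w 0 + n * (i + 1) ≤ w n := by
    intro n
    induction n with
    | zero => simp
    | succ n ih =>
      intro hn
      have h1 := hF.finrank_inf_add_orbit_le (hlt n hn).le (hu n hn) (hk n hn) (i := a * i + b)
      have h2 := hab (J n) (u n) (hu' n hn) i
      have h3 := ih (by omega)
      change w n + _ ≤ w (n + 1) at h1
      rw [add_mul, one_mul]
      omega
  have h0 : Module.finrank K (F (N - q)) ≤ w 0 := by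
    have : FiniteDimensional K ((J 0).restrictScalars K ⊓ F N : Submodule K D) :=
      Submodule.finiteDimensional_of_le inf_le_right
    -- Right multiplication by `x ∈ I ∩ F q`, injective because `D` is a domain.
    let ψ : F (N - q) →ₗ[K] ((J 0).restrictScalars K ⊓ F N : Submodule K D) :=
      LinearMap.codRestrict _ (LinearMap.mulRight K x ∘ₗ (F (N - q)).subtype) fun y => by
        refine ⟨?_, ?_⟩
        · refine (J 0).mul_mem_left _ ?_
          change I.mkQ x ∈ p ⟨_, _⟩
          rw [Submodule.mkQ_apply, (Submodule.Quotient.mk_eq_zero I).mpr hxI]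
          exact Submodule.zero_mem _
        · have := hF.mul_mem y.2 hq
          rwa [Nat.sub_add_cancel (by omega)] at this
    refine LinearMap.finrank_le_finrank_of_injective (f := ψ) fun y z hyz => ?_
    have := congrArg Subtype.val hyz
    exact Subtype.ext (mul_right_cancel₀ hx0 this)
  have h1 : w p.length ≤ Module.finrank K (F N) := Submodule.finrank_mono inf_le_right
  have h2 := hC (N - q)
  rw [Nat.sub_add_cancel (by omega : q ≤ N)] at h2
  have h3 := hstep _ le_rfl
  rw [hp] at h3 h1
  have h4 : (C * a + 1) * (i + 1) ≤ C * (N - q + 1) := by omega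
  have h5 : C * (N - q + 1) ≤ C * (N + 1) := Nat.mul_le_mul_left _ (by omega)
  have h6 : C * (N + 1) = C * a * i + i := by simp only [N, i]; ring
  have h7 : (C * a + 1) * (i + 1) = C * a * i + i + C * a + 1 := by ring
  omega

end IsBernsteinFiltration

/-! ### Finite differences of polynomials -/

section Polynomials

variable {K : Type*} [Field K]

theorem Polynomial.natDegree_taylor_sub_lt {p : K[X]} (hp : 0 < p.natDegree) (r : K) :
    (taylor r p - p).natDegree < p.natDegree := by
  by_cases h : taylor r p - p = 0
  · rwa [h, natDegree_zero]
  · refine natDegree_lt_natDegree h ?_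
    rw [← degree_taylor p r]
    refine degree_sub_lt_left (degree_taylor p r) ?_ (leadingCoeff_taylor r p)
    rw [Ne, taylor_eq_zero]
    rintro rfl
    simp at hp

theorem Polynomial.natDegree_taylor_sub_le {p : K[X]} {n : ℕ} (hp : p.natDegree ≤ n + 1) (r : K) :
    (taylor r p - p).natDegree ≤ n := by
  rcases Nat.eq_zero_or_pos p.natDegree with h | h
  · rw [eq_C_of_natDegree_eq_zero h, taylor_C, sub_self, natDegree_zero]
    exact Nat.zero_le _
  · have := natDegree_taylor_sub_lt h r
    omega

variable [CharZero K]

theorem Polynomial.eq_of_forall_ge_eval_natCast_eq {p q : K[X]} (N : ℕ)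
    (h : ∀ j : ℕ, N ≤ j → p.eval (j : K) = q.eval (j : K)) : p = q := by
  refine Polynomial.eq_of_infinite_eval_eq p q (Set.Infinite.mono ?_
    ((Set.Ici_infinite N).image (Nat.cast_injective (R := K)).injOn))
  rintro _ ⟨j, hj, rfl⟩
  exact h j hj

/-- A polynomial of period `r` would take the value `p(0)` at infinitely many points. -/
theorem Polynomial.taylor_sub_ne_zero {p : K[X]} (hp : 0 < p.natDegree) {r : ℕ} (hr : 0 < r) :
    taylor (r : K) p - p ≠ 0 := by
  intro h
  have h1 : ∀ n : ℕ, p.eval ((n * r : ℕ) : K) = p.eval 0 := fun n => by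
    induction n with
    | zero => simp
    | succ n ih =>
      rw [← ih, ← sub_eq_zero, ← eval_zero (x := ((n * r : ℕ) : K)), ← h, eval_sub, taylor_eval]
      push_cast
      ring_nf
  have h2 : p = C (p.eval 0) := by
    refine Polynomial.eq_of_infinite_eval_eq _ _ (Set.Infinite.mono ?_
      (Set.infinite_range_of_injective (f := fun n : ℕ => ((n * r : ℕ) : K)) fun a b hab => ?_))
    · rintro _ ⟨n, rfl⟩
      simpa using h1 n
    · exact Nat.eq_of_mul_eq_mul_right hr (Nat.cast_injective hab)
  rw [h2, natDegree_C] at hp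
  exact hp.false

/-- Discrete integration: the leading term is matched by a multiple of `X ^ (n + 2)`, whose
difference has leading coefficient `n + 2`, invertible in characteristic zero. -/
theorem Polynomial.exists_taylor_one_sub_eq (n : ℕ) (r : K[X]) (hr : r.natDegree ≤ n) :
    ∃ p : K[X], p.natDegree ≤ n + 1 ∧ taylor 1 p - p = r := by
  induction n generalizing r with
  | zero =>
    refine ⟨C (r.coeff 0) * X, by simpa using natDegree_C_mul_X_pow_le (r.coeff 0) 1, ?_⟩
    rw [taylor_mul, taylor_C, taylor_X, C_1, ← mul_sub, add_sub_cancel_left, mul_one]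
    exact (eq_C_of_natDegree_le_zero hr).symm
  | succ n ih =>
    let q : K[X] := C (r.coeff (n + 1) / (n + 2 : ℕ)) * X ^ (n + 2)
    have hq : q.natDegree ≤ n + 2 := natDegree_C_mul_X_pow_le _ _
    have hqc : (taylor 1 q - q).coeff (n + 1) = r.coeff (n + 1) := by
      have hn : ((n + 2 : ℕ) : K) ≠ 0 := Nat.cast_ne_zero.mpr (by omega)
      have hc : (n + 2).choose (n + 1) = n + 2 := Nat.choose_succ_self_right (n + 1)
      simp only [q, coeff_sub, taylor_mul, taylor_C, taylor_X_pow, C_1, coeff_C_mul,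
        coeff_X_add_one_pow, coeff_X_pow, hc]
      rw [if_neg (by omega), mul_zero, sub_zero, div_mul_cancel₀ _ hn]
    obtain ⟨p, hp, hpr⟩ := ih (r - (taylor 1 q - q)) (by
      have h1 := natDegree_sub_le_of_le hr (natDegree_taylor_sub_le hq (1 : K))
      rw [max_self] at h1
      refine natDegree_le_iff_coeff_eq_zero.mpr fun N hN => ?_
      rcases (Nat.succ_le_of_lt hN).eq_or_lt with h | h
      · rw [← h, coeff_sub, hqc, sub_self]
      · exact natDegree_le_iff_coeff_eq_zero.mp h1 N h)
    refine ⟨p + q, (natDegree_add_le_of_le hp hq).trans (by simp), ?_⟩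
    rw [map_add, add_sub_add_comm, hpr, sub_add_cancel]

end Polynomials

/-! ### Matrix entries of endomorphisms in the monomial basis -/

/-- The exponents of the monomials in `cuspAlgebra K m`. -/
def CuspExponent (m j : ℕ) : Prop := j = 0 ∨ m ≤ j

instance (m j : ℕ) : Decidable (CuspExponent m j) := inferInstanceAs (Decidable (_ ∨ _))

theorem CuspExponent.add {m i j : ℕ} (hi : CuspExponent m i) (hj : CuspExponent m j) :
    CuspExponent m (i + j) := by
  unfold CuspExponent at *
  omega

/-- The coefficient of a polynomial at an integral exponent. -/
noncomputable def intCoeff {K : Type*} [Field K] (l : ℤ) : K[X] →ₗ[K] K :=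
  if 0 ≤ l then lcoeff K l.toNat else 0

section IntCoeff

variable {K : Type*} [Field K]

@[simp] theorem intCoeff_natCast (l : ℕ) (p : K[X]) : intCoeff (l : ℤ) p = p.coeff l := by
  simp [intCoeff]

theorem intCoeff_of_neg {l : ℤ} (hl : l < 0) (p : K[X]) : intCoeff l p = 0 := by
  simp [intCoeff, hl.not_ge]

theorem intCoeff_X_pow_mul (l : ℤ) (s : ℕ) (p : K[X]) :
    intCoeff (l + s) (X ^ s * p) = intCoeff l p := by
  rcases le_or_gt 0 l with hl | hl
  · lift l to ℕ using hl
    rw [← Nat.cast_add, intCoeff_natCast, intCoeff_natCast, coeff_X_pow_mul]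
  · rw [intCoeff_of_neg hl]
    rcases le_or_gt 0 (l + s) with h | h
    · obtain ⟨t, ht⟩ := Int.eq_ofNat_of_zero_le h
      rw [ht, intCoeff_natCast, coeff_X_pow_mul', if_neg (by omega)]
    · exact intCoeff_of_neg h _

end IntCoeff

section Entries

variable {K : Type*} [Field K] {m : ℕ}

variable (K m) in
/-- The monomial `x ^ j` as an element of `cuspAlgebra K m`, or `0` if it does not lie there. -/
noncomputable def cuspMonomial (j : ℕ) : cuspAlgebra K m :=
  if h : CuspExponent m j then
    ⟨X ^ j, fun i hi him => by
      rw [coeff_X_pow, if_neg]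
      unfold CuspExponent at h
      omega⟩
  else 0

theorem coe_cuspMonomial {j : ℕ} (hj : CuspExponent m j) :
    (cuspMonomial K m j : K[X]) = X ^ j := by
  rw [cuspMonomial, dif_pos hj]

theorem cuspMonomial_mul {i j : ℕ} (hi : CuspExponent m i) (hj : CuspExponent m j) :
    cuspMonomial K m i * cuspMonomial K m j = cuspMonomial K m (i + j) := by
  refine Subtype.ext ?_
  rw [MulMemClass.coe_mul, coe_cuspMonomial hi, coe_cuspMonomial hj, coe_cuspMonomial (hi.add hj),
    pow_add]

theorem coeff_coe_eq_zero (a : cuspAlgebra K m) {j : ℕ} (hj : ¬ CuspExponent m j) :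
    (a : K[X]).coeff j = 0 := by
  unfold CuspExponent at hj
  exact a.2 j (by omega) (by omega)

theorem eq_sum_cuspMonomial (a : cuspAlgebra K m) :
    a = ∑ j ∈ (a : K[X]).support, (a : K[X]).coeff j • cuspMonomial K m j := by
  refine Subtype.ext ?_
  rw [AddSubmonoidClass.coe_finsetSum]
  conv_lhs => rw [as_sum_support_C_mul_X_pow (a : K[X])]
  refine Finset.sum_congr rfl fun j hj => ?_
  have : CuspExponent m j := by
    by_contra h
    exact mem_support_iff.mp hj (coeff_coe_eq_zero a h)
  rw [SetLike.val_smul, coe_cuspMonomial this, smul_eq_C_mul]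

theorem coe_eq_sum_intCoeff (a : cuspAlgebra K m) (j : ℕ) (s : Finset ℤ)
    (hs : ∀ k, intCoeff (j + k) (a : K[X]) ≠ 0 → k ∈ s) (hs' : ∀ k ∈ s, 0 ≤ j + k) :
    a = ∑ k ∈ s, intCoeff (j + k) (a : K[X]) • cuspMonomial K m (j + k).toNat := by
  conv_lhs => rw [eq_sum_cuspMonomial a]
  refine Finset.sum_of_injOn (fun n : ℕ => (n : ℤ) - j) ?_ ?_ ?_ ?_
  · intro x _ y _ h
    simpa using h
  · intro n hn
    refine hs _ ?_
    rw [add_sub_cancel, intCoeff_natCast]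
    exact mem_support_iff.mp hn
  · intro k hk hk'
    obtain ⟨n, hn⟩ := Int.eq_ofNat_of_zero_le (hs' k hk)
    rw [hn, intCoeff_natCast]
    rw [notMem_support_iff.mp, zero_smul]
    intro h
    exact hk' ⟨n, h, by dsimp only; omega⟩
  · intro n _
    rw [add_sub_cancel, intCoeff_natCast, Int.toNat_natCast]

theorem linearMap_ext_cuspMonomial {M : Type*} [AddCommGroup M] [Module K M]
    {f g : cuspAlgebra K m →ₗ[K] M}
    (h : ∀ j, CuspExponent m j → f (cuspMonomial K m j) = g (cuspMonomial K m j)) : f = g := by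
  refine LinearMap.ext fun a => ?_
  rw [eq_sum_cuspMonomial a, map_sum, map_sum]
  refine Finset.sum_congr rfl fun j hj => ?_
  rw [map_smul, map_smul, h j]
  by_contra h
  exact mem_support_iff.mp hj (coeff_coe_eq_zero a h)

/-- The coefficient of `x ^ (j + k)` in `f (x ^ j)`. -/
noncomputable def diagEntry (f : Module.End K (cuspAlgebra K m)) (k : ℤ) (j : ℕ) : K :=
  intCoeff (j + k) (f (cuspMonomial K m j) : K[X])

theorem ext_diagEntry {f g : Module.End K (cuspAlgebra K m)}
    (h : ∀ k j, CuspExponent m j → diagEntry f k j = diagEntry g k j) : f = g := by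
  refine linearMap_ext_cuspMonomial fun j hj => Subtype.ext (Polynomial.ext fun l => ?_)
  have := h (l - j) j hj
  simpa [diagEntry] using this

/-- Commuting with `x ^ s` becomes a finite difference along a diagonal. -/
theorem diagEntry_commutator (f : Module.End K (cuspAlgebra K m)) {s j : ℕ}
    (hs : CuspExponent m s) (hj : CuspExponent m j) (k : ℤ) :
    diagEntry (f * LinearMap.mulLeft K (cuspMonomial K m s) -
        LinearMap.mulLeft K (cuspMonomial K m s) * f) (k + s) j =
      diagEntry f k (j + s) - diagEntry f k j := by
  simp only [diagEntry, LinearMap.sub_apply, Module.End.mul_apply, LinearMap.mulLeft_apply,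
    AddSubgroupClass.coe_sub, map_sub, cuspMonomial_mul hs hj, MulMemClass.coe_mul,
    coe_cuspMonomial hs]
  rw [← add_assoc, intCoeff_X_pow_mul, add_comm s j]
  push_cast
  congr 3
  ring

end Entries

/-! ### Weight components of differential operators -/

section Symbol

variable {K : Type*} [Field K] {m : ℕ}

theorem DiffOps.exists_isDiffOp (f : DiffOps K (cuspAlgebra K m)) :
    ∃ n, IsDiffOp K (cuspAlgebra K m) n (DiffOps.val K _ f) := f.2

variable [CharZero K]

/-- By induction, all differences of the entries with steps `s` in the exponent set are polynomial.
Steps `m` and `m + 1` together give unit steps, which are integrated by `P`. -/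
theorem IsDiffOp.exists_diagEntry_eq {n : ℕ} {f : Module.End K (cuspAlgebra K m)}
    (hf : IsDiffOp K (cuspAlgebra K m) n f) (k : ℤ) :
    ∃ p : K[X], p.natDegree ≤ n ∧ ∀ j, CuspExponent m j → diagEntry f k j = p.eval (j : K) := by
  induction n generalizing f k with
  | zero =>
    refine ⟨C (diagEntry f k 0), by simp, fun j hj => ?_⟩
    have h := diagEntry_commutator f hj (Or.inl rfl) k
    rw [hf] at h
    simp only [diagEntry, LinearMap.zero_apply, ZeroMemClass.coe_zero, map_zero, zero_add] at h
    rw [eval_C]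
    exact (sub_eq_zero.mp h.symm)
  | succ n ih =>
    choose q hq hqe using fun s : ℕ => ih (hf (cuspMonomial K m s)) (k + s)
    have key : ∀ s j, CuspExponent m s → CuspExponent m j →
        diagEntry f k (j + s) = diagEntry f k j + (q s).eval (j : K) := fun s j hs hj => by
      rw [← hqe s j hj, diagEntry_commutator f hs hj]
      ring
    obtain ⟨P, hP, hPr⟩ := exists_taylor_one_sub_eq n (taylor (-(m : K)) (q (m + 1) - q m)) (by
      rw [natDegree_taylor]
      simpa using natDegree_sub_le_of_le (hq (m + 1)) (hq m))
    have hstep : ∀ j : ℕ, m ≤ j →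
        diagEntry f k (j + m + 1) - P.eval ((j + m + 1 : ℕ) : K) =
          diagEntry f k (j + m) - P.eval ((j + m : ℕ) : K) := fun j hj => by
      have h1 := congrArg (eval ((j + m : ℕ) : K)) hPr
      rw [eval_sub, taylor_eval, taylor_eval, eval_sub] at h1
      have h2 := key m j (Or.inr le_rfl) (Or.inr hj)
      have h3 := key (m + 1) j (Or.inr (Nat.le_succ m)) (Or.inr hj)
      rw [← add_assoc] at h3
      rw [h2, h3]
      push_cast at h1 ⊢
      rw [add_neg_cancel_right] at h1
      linear_combination -h1
    -- Beyond `2 * m` the entries are `P` plus a constant; the step `m + m` then carries this back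
    -- to every exponent, including `0`.
    have hconst : ∀ i : ℕ, diagEntry f k (m + m + i) - P.eval ((m + m + i : ℕ) : K) =
        diagEntry f k (m + m) - P.eval ((m + m : ℕ) : K) := fun i => by
      induction i with
      | zero => rfl
      | succ i ih =>
        rw [← ih]
        have := hstep (m + i) (by omega)
        rwa [show m + i + m = m + m + i by ring] at this
    refine ⟨taylor ((m + m : ℕ) : K) P + C (diagEntry f k (m + m) - P.eval ((m + m : ℕ) : K)) -
      q (m + m), ?_, fun j hj => ?_⟩
    · refine natDegree_sub_le_of_le (m := n + 1) (n := n + 1) ?_ ((hq _).trans (by omega)) |>.trans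
        (by simp)
      exact natDegree_add_le_of_le (m := n + 1) (n := n + 1) (by rwa [natDegree_taylor])
        (by simp) |>.trans (by simp)
    · have h1 := key (m + m) j (Or.inr (by omega)) hj
      have h2 := hconst j
      rw [eval_sub, eval_add, taylor_eval, eval_C]
      rw [add_comm (m + m) j, h1] at h2
      push_cast at h2 ⊢
      linear_combination h2

theorem DiffOps.exists_symbol (f : DiffOps K (cuspAlgebra K m)) (k : ℤ) :
    ∃ p : K[X], ∀ j, CuspExponent m j → diagEntry (DiffOps.val K _ f) k j = p.eval (j : K) := by
  obtain ⟨n, hn⟩ := DiffOps.exists_isDiffOp f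
  obtain ⟨p, _, hp⟩ := hn.exists_diagEntry_eq k
  exact ⟨p, hp⟩

/-- The component of weight `k` of a differential operator on `cuspAlgebra K m`: the polynomial
`p` such that this component is `x ^ j ↦ p j • x ^ (j + k)`. -/
noncomputable def symbol : DiffOps K (cuspAlgebra K m) →ₗ[K] (ℤ → K[X]) where
  toFun f k := Classical.choose (DiffOps.exists_symbol f k)
  map_add' f g := by
    funext k
    refine eq_of_forall_ge_eval_natCast_eq m fun j hj => ?_
    rw [Pi.add_apply, eval_add, ← Classical.choose_spec (DiffOps.exists_symbol f k) j (Or.inr hj),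
      ← Classical.choose_spec (DiffOps.exists_symbol g k) j (Or.inr hj),
      ← Classical.choose_spec (DiffOps.exists_symbol (f + g) k) j (Or.inr hj)]
    simp [diagEntry]
  map_smul' c f := by
    funext k
    refine eq_of_forall_ge_eval_natCast_eq m fun j hj => ?_
    rw [Pi.smul_apply, RingHom.id_apply, eval_smul,
      ← Classical.choose_spec (DiffOps.exists_symbol f k) j (Or.inr hj),
      ← Classical.choose_spec (DiffOps.exists_symbol (c • f) k) j (Or.inr hj)]
    simp [diagEntry]

theorem diagEntry_val (f : DiffOps K (cuspAlgebra K m)) (k : ℤ) {j : ℕ} (hj : CuspExponent m j) :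
    diagEntry (DiffOps.val K _ f) k j = (symbol f k).eval (j : K) :=
  Classical.choose_spec (DiffOps.exists_symbol f k) j hj

theorem symbol_eq_of_forall_ge {f : DiffOps K (cuspAlgebra K m)} {k : ℤ} {p : K[X]} (N : ℕ)
    (h : ∀ j, N ≤ j → m ≤ j → diagEntry (DiffOps.val K _ f) k j = p.eval (j : K)) :
    symbol f k = p :=
  eq_of_forall_ge_eval_natCast_eq (max N m) fun j hj => by
    rw [← diagEntry_val f k (Or.inr ((le_max_right _ _).trans hj)),
      h j ((le_max_left _ _).trans hj) ((le_max_right _ _).trans hj)]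

theorem symbol_injective :
    Function.Injective (symbol : DiffOps K (cuspAlgebra K m) →ₗ[K] (ℤ → K[X])) := by
  intro f g h
  refine DiffOps.val_injective K _ (ext_diagEntry fun k j hj => ?_)
  rw [diagEntry_val f k hj, diagEntry_val g k hj, h]

/-- A nonzero component of degree at most `n` is nonzero at one of `m, …, m + n`, so its weight is
visible in the image of one of finitely many monomials. -/
theorem exists_symbol_bound (f : DiffOps K (cuspAlgebra K m)) :
    ∃ i : ℕ, ∀ k, (symbol f k).natDegree ≤ i ∧ (symbol f k ≠ 0 → k.natAbs ≤ i) := by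
  obtain ⟨n, hn⟩ := DiffOps.exists_isDiffOp f
  have hdeg : ∀ k, (symbol f k).natDegree ≤ n := fun k => by
    obtain ⟨p, hp, hpe⟩ := hn.exists_diagEntry_eq k
    rwa [symbol_eq_of_forall_ge 0 fun j _ hj => hpe j (Or.inr hj)]
  let d : ℕ := (Finset.range (n + 1)).sup fun t =>
    (DiffOps.val K _ f (cuspMonomial K m (m + t)) : K[X]).natDegree
  refine ⟨n + m + d, fun k => ⟨(hdeg k).trans (by omega), fun hk => ?_⟩⟩
  obtain ⟨t, ht, hne⟩ : ∃ t ≤ n, (symbol f k).eval ((m + t : ℕ) : K) ≠ 0 := by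
    by_contra! h
    refine hk (Polynomial.eq_zero_of_natDegree_lt_card_of_eval_eq_zero (symbol f k)
      (f := fun t : Fin (n + 1) => ((m + t : ℕ) : K)) (fun a b hab => ?_)
      (fun t => h t (by omega)) ?_)
    · have := Nat.cast_injective (R := K) hab
      exact Fin.ext (by omega)
    · rw [Fintype.card_fin]
      exact Nat.lt_succ_of_le (hdeg k)
  rw [← diagEntry_val f k (Or.inr (by omega)), diagEntry] at hne
  have h0 : 0 ≤ ((m + t : ℕ) : ℤ) + k := by
    by_contra! h
    exact hne (intCoeff_of_neg h _)
  obtain ⟨l, hl⟩ := Int.eq_ofNat_of_zero_le h0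
  rw [hl, intCoeff_natCast] at hne
  have h1 := le_natDegree_of_ne_zero hne
  have h2 : l ≤ d := h1.trans (Finset.le_sup
    (f := fun t => (DiffOps.val K _ f (cuspMonomial K m (m + t)) : K[X]).natDegree)
    (Finset.mem_range.mpr (Nat.lt_succ_of_le ht)))
  omega

theorem symbol_mul (f g : DiffOps K (cuspAlgebra K m)) (s : Finset ℤ)
    (hs : ∀ l, symbol g l ≠ 0 → l ∈ s) (k : ℤ) :
    symbol (f * g) k = ∑ l ∈ s, taylor (l : K) (symbol f (k - l)) * symbol g l := by
  let N : ℕ := s.sup Int.natAbs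
  have hN : ∀ l ∈ s, l.natAbs ≤ N := fun l hl => Finset.le_sup (f := Int.natAbs) hl
  -- For `j ≥ N + m` every `j + l` with `l ∈ s` is an admissible exponent, where the polynomial of
  -- `f` applies.
  refine symbol_eq_of_forall_ge (N + m) fun j hj hmj => ?_
  have hjS : CuspExponent m j := Or.inr hmj
  have hg := coe_eq_sum_intCoeff (DiffOps.val K _ g (cuspMonomial K m j)) j s (fun l hl => by
    refine hs l fun h0 => hl ?_
    have := diagEntry_val g l hjS
    rwa [h0, eval_zero] at this) (fun l hl => by have := hN l hl; omega)
  rw [diagEntry, map_mul, Module.End.mul_apply, hg, map_sum, AddSubmonoidClass.coe_finsetSum,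
    map_sum, eval_finsetSum]
  refine Finset.sum_congr rfl fun l hl => ?_
  have h1 := diagEntry_val g l hjS
  rw [diagEntry] at h1
  have hl' := hN l hl
  obtain ⟨t, ht⟩ := Int.eq_ofNat_of_zero_le (show 0 ≤ (j : ℤ) + l by omega)
  have h2 := diagEntry_val f (k - l) (j := t) (Or.inr (by omega))
  rw [diagEntry, ← ht, show (j : ℤ) + l + (k - l) = j + k by ring] at h2
  rw [h1, map_smul, SetLike.val_smul, map_smul, ht, Int.toNat_natCast, h2, smul_eq_mul, eval_mul,
    taylor_eval, mul_comm]
  congr 2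
  have := congrArg (Int.cast (R := K)) ht
  push_cast at this
  exact this.symm

end Symbol

/-! ### Homogeneous operators and absence of zero divisors -/

section WeightOperators

theorem IsDiffOp.smul {R A : Type*} [CommRing R] [CommRing A] [Algebra R A] {n : ℕ}
    {f : Module.End R A} (hf : IsDiffOp R A n f) (c : R) : IsDiffOp R A n (c • f) := by
  have h : IsDiffOp R A 0 (algebraMap R (Module.End R A) c) := fun a => by
    rw [Algebra.commutes c (LinearMap.mulLeft R a), sub_self]
  have := h.mul hf
  rwa [zero_add, ← Algebra.smul_def] at this

theorem IsDiffOp.sum {R A ι : Type*} [CommRing R] [CommRing A] [Algebra R A] {n : ℕ}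
    {f : ι → Module.End R A} {s : Finset ι} (hf : ∀ i ∈ s, IsDiffOp R A n (f i)) :
    IsDiffOp R A n (∑ i ∈ s, f i) :=
  Finset.sum_induction f (IsDiffOp R A n) (fun _ _ => IsDiffOp.add) (IsDiffOp.zero n) hf

theorem commutator_mulLeft_sum {R A ι : Type*} [CommRing R] [CommRing A] [Algebra R A]
    (f : Module.End R A) (s : Finset ι) (c : ι → R) (e : ι → A) :
    f * LinearMap.mulLeft R (∑ i ∈ s, c i • e i) - LinearMap.mulLeft R (∑ i ∈ s, c i • e i) * f =
      ∑ i ∈ s, c i • (f * LinearMap.mulLeft R (e i) - LinearMap.mulLeft R (e i) * f) := by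
  refine LinearMap.ext fun x => ?_
  simp [Finset.sum_mul, Finset.sum_sub_distrib, smul_sub]

variable {K : Type*} [Field K] {m : ℕ}

/-- A commutator with `x ^ s` replaces `p` by `taylor s p - p`, of smaller degree. -/
theorem isDiffOp_of_diagEntry {n : ℕ} {f : Module.End K (cuspAlgebra K m)} {k : ℤ} {p : K[X]}
    (hp : p.natDegree ≤ n)
    (hf : ∀ l j, CuspExponent m j → diagEntry f l j = if l = k then p.eval (j : K) else 0) :
    IsDiffOp K (cuspAlgebra K m) n f := by
  have hcomm : ∀ (f : Module.End K (cuspAlgebra K m)) (k : ℤ) (p : K[X]),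
      (∀ l j, CuspExponent m j → diagEntry f l j = if l = k then p.eval (j : K) else 0) →
      ∀ s, CuspExponent m s → ∀ l j, CuspExponent m j →
        diagEntry (f * LinearMap.mulLeft K (cuspMonomial K m s) -
          LinearMap.mulLeft K (cuspMonomial K m s) * f) l j =
            if l = k + s then (taylor (s : K) p - p).eval (j : K) else 0 := by
    intro f k p hf s hs l j hj
    obtain ⟨l, rfl⟩ : ∃ l', l = l' + (s : ℤ) := ⟨l - s, by ring⟩
    rw [diagEntry_commutator f hs hj, hf l _ (hj.add hs), hf l _ hj]
    simp only [add_left_inj]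
    split_ifs
    · rw [eval_sub, taylor_eval, Nat.cast_add]
    · rw [sub_zero]
  have hS : ∀ (a : cuspAlgebra K m), ∀ s ∈ (a : K[X]).support, CuspExponent m s := by
    intro a s hs
    by_contra h
    exact mem_support_iff.mp hs (coeff_coe_eq_zero a h)
  induction n generalizing f k p with
  | zero =>
    intro a
    rw [eq_sum_cuspMonomial a, commutator_mulLeft_sum]
    refine Finset.sum_eq_zero fun s hs => ?_
    refine (congrArg _ (ext_diagEntry (g := 0) fun l j hj => ?_)).trans (smul_zero _)
    rw [hcomm f k p hf s (hS a s hs) l j hj, eq_C_of_natDegree_le_zero hp]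
    simp [diagEntry]
  | succ n ih =>
    intro a
    rw [eq_sum_cuspMonomial a, commutator_mulLeft_sum]
    exact IsDiffOp.sum fun s hs =>
      (ih (natDegree_taylor_sub_le hp _) (hcomm f k p hf s (hS a s hs))).smul _

/-- The linear map `x ^ j ↦ p j • x ^ (j + k)` of `K[x]`, where negative powers of `x` are
replaced with `1`. -/
noncomputable def weightMap (p : K[X]) (k : ℤ) : K[X] →ₗ[K] K[X] :=
  Polynomial.lsum fun j => p.eval (j : K) • monomial (j + k).toNat

theorem weightMap_X_pow (p : K[X]) (k : ℤ) (j : ℕ) :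
    weightMap p k (X ^ j) = monomial (j + k).toNat (p.eval (j : K)) := by
  rw [weightMap, lsum_apply, X_pow_eq_monomial, sum_monomial_index _ _ (by simp)]
  simp [smul_monomial]

/-- The operator `x ^ j ↦ p j • x ^ (j + k)` preserves `cuspAlgebra K m`. -/
def PreservesCusp (m : ℕ) (p : K[X]) (k : ℤ) : Prop :=
  ∀ j : ℕ, CuspExponent m j → p.eval (j : K) ≠ 0 → 0 ≤ j + k ∧ CuspExponent m (j + k).toNat

theorem weightMap_mem {p : K[X]} {k : ℤ} (h : PreservesCusp m p k) (a : cuspAlgebra K m) :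
    weightMap p k a ∈ Subalgebra.toSubmodule (cuspAlgebra K m) := by
  rw [eq_sum_cuspMonomial a, AddSubmonoidClass.coe_finsetSum, map_sum]
  refine Submodule.sum_mem _ fun j hj => ?_
  have hjS : CuspExponent m j := by
    by_contra h
    exact mem_support_iff.mp hj (coeff_coe_eq_zero a h)
  rw [SetLike.val_smul, map_smul, coe_cuspMonomial hjS, weightMap_X_pow]
  refine Submodule.smul_mem _ _ fun i hi him => ?_
  rw [coeff_monomial]
  split_ifs with hi'
  · by_contra h0
    have := (h j hjS h0).2
    unfold CuspExponent at this
    omega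
  · rfl

/-- The differential operator `x ^ j ↦ p j • x ^ (j + k)` on `cuspAlgebra K m`. -/
noncomputable def weightEnd (p : K[X]) (k : ℤ) (h : PreservesCusp m p k) :
    Module.End K (cuspAlgebra K m) :=
  LinearMap.codRestrict (Subalgebra.toSubmodule (cuspAlgebra K m))
    (weightMap p k ∘ₗ (Subalgebra.toSubmodule (cuspAlgebra K m)).subtype) (weightMap_mem h)

theorem diagEntry_weightEnd {p : K[X]} {k : ℤ} (h : PreservesCusp m p k) (l : ℤ) {j : ℕ}
    (hj : CuspExponent m j) :
    diagEntry (weightEnd p k h) l j = if l = k then p.eval (j : K) else 0 := by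
  have h1 : (weightEnd p k h (cuspMonomial K m j) : K[X]) =
      monomial (j + k).toNat (p.eval (j : K)) := by
    rw [← weightMap_X_pow, ← coe_cuspMonomial hj]
    rfl
  rw [diagEntry, h1]
  by_cases h0 : p.eval (j : K) = 0
  · simp [h0]
  · obtain ⟨t, ht⟩ := Int.eq_ofNat_of_zero_le (h j hj h0).1
    rw [ht, Int.toNat_natCast]
    rcases le_or_gt 0 ((j : ℤ) + l) with hl | hl
    · obtain ⟨r, hr⟩ := Int.eq_ofNat_of_zero_le hl
      rw [hr, intCoeff_natCast, coeff_monomial]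
      exact if_congr (by omega) rfl rfl
    · rw [intCoeff_of_neg hl, if_neg (by omega)]

/-- The differential operator `x ^ j ↦ p j • x ^ (j + k)` on `cuspAlgebra K m`. -/
noncomputable def weightOp (p : K[X]) (k : ℤ) (h : PreservesCusp m p k) :
    DiffOps K (cuspAlgebra K m) :=
  ⟨weightEnd p k h, p.natDegree, isDiffOp_of_diagEntry le_rfl fun l _ hj =>
    diagEntry_weightEnd h l hj⟩

theorem symbol_weightOp [CharZero K] {p : K[X]} {k : ℤ} (h : PreservesCusp m p k) :
    symbol (weightOp p k h) = Pi.single k p := by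
  funext l
  refine symbol_eq_of_forall_ge 0 fun j _ hj => ?_
  refine (diagEntry_weightEnd h l (Or.inr hj)).trans ?_
  rw [Pi.single_apply]
  split_ifs <;> simp

theorem preservesCusp_zero (p : K[X]) : PreservesCusp m p 0 := fun j hj _ =>
  ⟨by omega, by simpa using hj⟩

theorem preservesCusp_natCast (p : K[X]) {s : ℕ} (hs : CuspExponent m s) :
    PreservesCusp m p s := fun j hj _ =>
  ⟨by omega, by rw [← Nat.cast_add, Int.toNat_natCast]; exact hj.add hs⟩

variable [CharZero K]

theorem symbol_mul_of_single {f g : DiffOps K (cuspAlgebra K m)} {k l : ℤ} {p q : K[X]}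
    (hf : symbol f = Pi.single k p) (hg : symbol g = Pi.single l q) :
    symbol (f * g) = Pi.single (k + l) (taylor (l : K) p * q) := by
  funext t
  rw [symbol_mul f g {l} (fun t ht => by
    by_contra h
    rw [hg, Pi.single_eq_of_ne (by simpa using h)] at ht
    exact ht rfl), Finset.sum_singleton, hf, hg, Pi.single_eq_same]
  rcases eq_or_ne t (k + l) with rfl | ht
  · rw [add_sub_cancel_right, Pi.single_eq_same, Pi.single_eq_same]
  · rw [Pi.single_eq_of_ne ht, Pi.single_eq_of_ne (by omega), map_zero, zero_mul]

theorem symbol_one : symbol (1 : DiffOps K (cuspAlgebra K m)) = Pi.single 0 1 := by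
  have h : (1 : DiffOps K (cuspAlgebra K m)) = weightOp 1 0 (preservesCusp_zero 1) := by
    refine DiffOps.val_injective K _ (ext_diagEntry fun l j hj => ?_)
    rw [diagEntry_val (weightOp _ _ _) _ hj, symbol_weightOp, map_one, diagEntry,
      Module.End.one_apply, coe_cuspMonomial hj]
    rcases eq_or_ne l 0 with rfl | hl
    · simp
    · rw [Pi.single_eq_of_ne hl, eval_zero]
      rcases le_or_gt 0 ((j : ℤ) + l) with h | h
      · obtain ⟨r, hr⟩ := Int.eq_ofNat_of_zero_le h
        rw [hr, intCoeff_natCast, coeff_X_pow, if_neg (by omega)]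
      · exact intCoeff_of_neg h _
  rw [h, symbol_weightOp]

theorem symbol_euler_mul (f : DiffOps K (cuspAlgebra K m)) (k : ℤ) :
    symbol (weightOp X 0 (preservesCusp_zero X) * f) k = (X + C (k : K)) * symbol f k := by
  obtain ⟨i, hi⟩ := exists_symbol_bound f
  rw [symbol_mul _ f (insert k (Finset.Icc (-(i : ℤ)) i)) (fun l hl => ?_),
    Finset.sum_eq_single k, symbol_weightOp, sub_self, Pi.single_eq_same, taylor_X]
  · intro l _ hl
    rw [symbol_weightOp, Pi.single_eq_of_ne (sub_ne_zero.mpr hl.symm), map_zero, zero_mul]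
  · intro h
    exact absurd (Finset.mem_insert_self _ _) h
  · have := (hi l).2 hl
    exact Finset.mem_insert_of_mem (Finset.mem_Icc.mpr (by omega))

theorem symbol_mul_euler (f : DiffOps K (cuspAlgebra K m)) (k : ℤ) :
    symbol (f * weightOp X 0 (preservesCusp_zero X)) k = symbol f k * X := by
  rw [symbol_mul f _ {0} (fun l hl => ?_), Finset.sum_singleton, symbol_weightOp,
    Pi.single_eq_same, sub_zero, Int.cast_zero, taylor_zero]
  by_contra h
  rw [symbol_weightOp, Pi.single_eq_of_ne (by simpa using h)] at hl
  exact hl rfl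

theorem exists_top_symbol {f : DiffOps K (cuspAlgebra K m)} (hf : f ≠ 0) :
    ∃ k, symbol f k ≠ 0 ∧ ∀ l, k < l → symbol f l = 0 := by
  obtain ⟨i, hi⟩ := exists_symbol_bound f
  obtain ⟨k, hk⟩ : ∃ k, symbol f k ≠ 0 := by
    by_contra! h
    refine hf (symbol_injective ?_)
    rw [map_zero]
    exact funext h
  have hbdd : ∀ l, symbol f l ≠ 0 → l ≤ (i : ℤ) := fun l hl => by
    have := (hi l).2 hl
    omega
  obtain ⟨t, ht, hmax⟩ := Int.exists_greatest_of_bdd ⟨_, hbdd⟩ ⟨k, hk⟩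
  refine ⟨t, ht, fun l hl => ?_⟩
  by_contra h
  exact absurd (hmax l h) (by omega)

-- The components of highest weight multiply to a nonzero component.
instance : NoZeroDivisors (DiffOps K (cuspAlgebra K m)) where
  eq_zero_or_eq_zero_of_mul_eq_zero {f g} h := by
    by_contra! hfg
    obtain ⟨k, hk, hk'⟩ := exists_top_symbol hfg.1
    obtain ⟨l, hl, hl'⟩ := exists_top_symbol hfg.2
    obtain ⟨i, hi⟩ := exists_symbol_bound g
    have h1 := symbol_mul f g (insert l (Finset.Icc (-(i : ℤ)) i)) (fun t ht => by
      have := (hi t).2 ht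
      exact Finset.mem_insert_of_mem (Finset.mem_Icc.mpr (by omega))) (k + l)
    rw [Finset.sum_eq_single l, h, map_zero, add_sub_cancel_right, Pi.zero_apply] at h1
    · exact mul_ne_zero (by rwa [Ne, taylor_eq_zero]) hl h1.symm
    · intro t _ ht
      rcases lt_or_gt_of_ne ht with h' | h'
      · rw [hk' _ (by omega), map_zero, zero_mul]
      · rw [hl' t h', mul_zero]
    · intro h'
      exact absurd (Finset.mem_insert_self _ _) h'

end WeightOperators

/-! ### The filtration by weight and degree -/

section Filtration

variable (K : Type*) [Field K] [CharZero K] (m : ℕ)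

/-- The index set of the coefficients of the operators `x ^ k * h ^ n` with `|k| ≤ i`, `n ≤ i`. -/
noncomputable def symbolBox (i : ℕ) : Finset (ℤ × ℕ) := Finset.Icc (-(i : ℤ)) i ×ˢ Finset.range (i + 1)

theorem mem_symbolBox {i n : ℕ} {k : ℤ} : (k, n) ∈ symbolBox i ↔ k.natAbs ≤ i ∧ n ≤ i := by
  rw [symbolBox, Finset.mem_product, Finset.mem_Icc, Finset.mem_range]
  dsimp only
  omega

theorem card_symbolBox (i : ℕ) : (symbolBox i).card = (2 * i + 1) * (i + 1) := by
  rw [symbolBox, Finset.card_product, Int.card_Icc, Finset.card_range]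
  congr 1
  omega

/-- The operators whose components have weights between `-i` and `i` and degrees at most `i`. -/
noncomputable def cuspFiltration (i : ℕ) : Submodule K (DiffOps K (cuspAlgebra K m)) where
  carrier := {f | ∀ k n, (k, n) ∉ symbolBox i → (symbol f k).coeff n = 0}
  zero_mem' k n _ := by simp
  add_mem' {f g} hf hg k n h := by simp [hf k n h, hg k n h]
  smul_mem' c f hf k n h := by simp [hf k n h]

variable {K m}

theorem mem_cuspFiltration {f : DiffOps K (cuspAlgebra K m)} {i : ℕ} :
    f ∈ cuspFiltration K m i ↔
      ∀ k, (symbol f k).natDegree ≤ i ∧ (symbol f k ≠ 0 → k.natAbs ≤ i) := by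
  change (∀ k n, (k, n) ∉ symbolBox i → (symbol f k).coeff n = 0) ↔ _
  simp only [mem_symbolBox]
  constructor
  · refine fun h k => ⟨natDegree_le_iff_coeff_eq_zero.mpr fun n hn => h k n (by omega), ?_⟩
    intro hk
    by_contra hki
    exact hk (Polynomial.ext fun n => h k n fun h' => hki h'.1)
  · intro h k n hkn
    by_cases hk : symbol f k = 0
    · rw [hk, coeff_zero]
    · exact natDegree_le_iff_coeff_eq_zero.mp (h k).1 n (by have := (h k).2 hk; omega)

theorem mem_cuspFiltration_of_single {f : DiffOps K (cuspAlgebra K m)} {k : ℤ} {p : K[X]}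
    (hf : symbol f = Pi.single k p) {i : ℕ} (hp : p.natDegree ≤ i) (hk : k.natAbs ≤ i) :
    f ∈ cuspFiltration K m i := by
  refine mem_cuspFiltration.mpr fun l => ?_
  rw [hf]
  rcases eq_or_ne l k with rfl | hl
  · rw [Pi.single_eq_same]
    exact ⟨hp, fun _ => hk⟩
  · rw [Pi.single_eq_of_ne hl]
    simp

theorem cuspFiltration_mono : Monotone (cuspFiltration K m) := by
  intro i j hij f hf
  rw [mem_cuspFiltration] at hf ⊢
  exact fun k => ⟨(hf k).1.trans hij, fun h => ((hf k).2 h).trans hij⟩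

theorem cuspFiltration_mul_mem {i j : ℕ} {f g : DiffOps K (cuspAlgebra K m)}
    (hf : f ∈ cuspFiltration K m i) (hg : g ∈ cuspFiltration K m j) :
    f * g ∈ cuspFiltration K m (i + j) := by
  rw [mem_cuspFiltration] at hf hg ⊢
  intro k
  rw [symbol_mul f g (Finset.Icc (-(j : ℤ)) j) fun l hl => by
    have := (hg l).2 hl
    exact Finset.mem_Icc.mpr (by omega)]
  constructor
  · refine natDegree_sum_le_of_forall_le _ _ fun l _ => natDegree_mul_le_of_le ?_ (hg l).1
    rw [natDegree_taylor]
    exact (hf _).1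
  · intro h
    obtain ⟨l, _, hl⟩ := Finset.exists_ne_zero_of_sum_ne_zero h
    have h1 := (hg l).2 (right_ne_zero_of_mul hl)
    have h2 := (hf (k - l)).2 fun h0 => left_ne_zero_of_mul hl (by rw [h0, map_zero])
    omega

variable (K m) in
/-- The coefficients of the components of a differential operator at the indices in `T`. -/
noncomputable def symbolCoeffs (T : Finset (ℤ × ℕ)) :
    DiffOps K (cuspAlgebra K m) →ₗ[K] (T → K) :=
  LinearMap.pi fun t => lcoeff K t.1.2 ∘ₗ LinearMap.proj t.1.1 ∘ₗ symbol

instance cuspFiltration_finite (i : ℕ) : FiniteDimensional K (cuspFiltration K m i) := by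
  refine Module.Finite.of_injective (symbolCoeffs K m (symbolBox i) ∘ₗ
    (cuspFiltration K m i).subtype) ?_
  rw [← LinearMap.ker_eq_bot, LinearMap.ker_eq_bot']
  intro f hf
  refine Subtype.ext (symbol_injective (funext fun k => Polynomial.ext fun n => ?_))
  rw [ZeroMemClass.coe_zero, map_zero, Pi.zero_apply, coeff_zero]
  by_cases h : (k, n) ∈ symbolBox i
  · exact congrFun hf ⟨(k, n), h⟩
  · exact f.2 k n h

/-- Operators whose coefficients vanish on the difference of the two boxes lie in the smaller space,
so the codimension is at most the number of added indices. -/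
theorem finrank_cuspFiltration_add_le (i k : ℕ) :
    Module.finrank K (cuspFiltration K m (i + k)) ≤
      Module.finrank K (cuspFiltration K m i) + 4 * k * (k + 1) * (i + 1) := by
  let T := symbolBox (i + k) \ symbolBox i
  let φ := symbolCoeffs K m T ∘ₗ (cuspFiltration K m (i + k)).subtype
  have h := LinearMap.finrank_range_add_finrank_ker φ
  have h1 : Module.finrank K (LinearMap.range φ) ≤ T.card := by
    refine (Submodule.finrank_le _).trans ?_
    rw [Module.finrank_fintype_fun_eq_card, Fintype.card_coe]
  have h2 : Module.finrank K (LinearMap.ker φ) ≤ Module.finrank K (cuspFiltration K m i) := by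
    let ψ : LinearMap.ker φ →ₗ[K] cuspFiltration K m i :=
      LinearMap.codRestrict _ ((cuspFiltration K m (i + k)).subtype ∘ₗ (LinearMap.ker φ).subtype)
        fun f l n hln => by
          by_cases h : (l, n) ∈ symbolBox (i + k)
          · exact congrFun (LinearMap.mem_ker.mp f.2) ⟨(l, n), Finset.mem_sdiff.mpr ⟨h, hln⟩⟩
          · exact f.1.2 l n h
    refine LinearMap.finrank_le_finrank_of_injective (f := ψ) fun x y hxy => ?_
    exact Subtype.ext (Subtype.ext (congrArg
      (fun z : cuspFiltration K m i => (z : DiffOps K (cuspAlgebra K m))) hxy))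
  have h3 : T.card ≤ 4 * k * (k + 1) * (i + 1) := by
    have hsub : symbolBox i ⊆ symbolBox (i + k) := by
      rintro ⟨l, n⟩ h
      rw [mem_symbolBox] at h ⊢
      omega
    rw [Finset.card_sdiff_of_subset hsub, card_symbolBox, card_symbolBox, Nat.sub_le_iff_le_add]
    have : 0 ≤ k * (i * k) := Nat.zero_le _
    rcases Nat.eq_zero_or_pos k with rfl | hk
    · simp
    · nlinarith [Nat.mul_le_mul hk hk]
  omega

/-- For weights `k ≥ m` every polynomial is allowed, since `x ^ k ∈ A`; weights `m, …, i + m` and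
degrees `0, …, i` suffice. -/
theorem sq_le_finrank_cuspFiltration (i : ℕ) :
    (i + 1) ^ 2 ≤ Module.finrank K (cuspFiltration K m (i + m)) := by
  let T : Finset (ℤ × ℕ) :=
    (Finset.Icc (m : ℤ) (i + m)) ×ˢ Finset.range (i + 1)
  let φ := symbolCoeffs K m T ∘ₗ (cuspFiltration K m (i + m)).subtype
  have hφ : Function.Surjective φ := by
    rw [← LinearMap.range_eq_top, eq_top_iff, ← (Pi.basisFun K T).span_eq, Submodule.span_le]
    rintro _ ⟨⟨⟨k, n⟩, ht⟩, rfl⟩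
    have ht' := ht
    rw [Finset.mem_product, Finset.mem_Icc, Finset.mem_range] at ht'
    dsimp only at ht'
    obtain ⟨s, rfl⟩ := Int.eq_ofNat_of_zero_le (show 0 ≤ k by omega)
    have hsym := symbol_weightOp (preservesCusp_natCast (m := m) (X ^ n : K[X]) (s := s)
      (Or.inr (by omega)))
    refine ⟨⟨weightOp _ _ _, mem_cuspFiltration_of_single hsym ?_ ?_⟩, ?_⟩
    · rw [natDegree_X_pow]
      omega
    · omega
    · funext ⟨⟨l, r⟩, h⟩
      rw [Pi.basisFun_apply]
      change (symbol (weightOp _ _ _) l).coeff r = _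
      rw [hsym]
      rcases eq_or_ne l s with rfl | hl
      · rw [Pi.single_eq_same, coeff_X_pow, Pi.single_apply]
        refine if_congr ?_ rfl rfl
        simp
      · rw [Pi.single_eq_of_ne hl, coeff_zero, Pi.single_eq_of_ne]
        intro h
        exact hl (congrArg (fun z : T => z.1.1) h)
  have h := LinearMap.finrank_range_add_finrank_ker φ
  rw [LinearMap.range_eq_top.mpr hφ, finrank_top, Module.finrank_fintype_fun_eq_card,
    Fintype.card_coe, Finset.card_product, Int.card_Icc, Finset.card_range] at h
  rw [sq, ← h]
  refine le_trans (Nat.mul_le_mul_right _ ?_) (Nat.le_add_right _ _)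
  omega

end Filtration

/-! ### Quantitative simplicity -/

section Annihilators

/-- A polynomial whose roots are the exponents `j` for which `x ^ (j - k)` is not in
`cuspAlgebra K m`. -/
theorem exists_preservesCusp_neg (K : Type*) [Field K] [CharZero K] (m k : ℕ) :
    ∃ g : K[X], g.natDegree ≤ k + m ∧ PreservesCusp m g (-(k : ℤ)) ∧
      IsCoprime g (taylor (k : K) g) := by
  let R := (Finset.range (k + m)).filter fun j =>
    CuspExponent m j ∧ ¬ (k ≤ j ∧ CuspExponent m (j - k))
  let g : K[X] := ∏ j ∈ R, (X - C (j : K))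
  have hR : ∀ {j}, j ∈ R ↔ j < k + m ∧ CuspExponent m j ∧ ¬ (k ≤ j ∧ CuspExponent m (j - k)) := by
    simp [R]
  refine ⟨g, ?_, fun j hj hgj => ?_, ?_⟩
  · refine (natDegree_prod_le _ _).trans ?_
    simp only [natDegree_X_sub_C, Finset.sum_const, smul_eq_mul, mul_one]
    exact (Finset.card_filter_le _ _).trans (by rw [Finset.card_range])
  · have hjR : j ∉ R := fun h => hgj (by
      rw [eval_prod]
      exact Finset.prod_eq_zero h (by simp))
    have h1 : k ≤ j ∧ CuspExponent m (j - k) := by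
      by_contra h
      refine hjR (hR.mpr ⟨?_, hj, h⟩)
      by_contra h'
      exact h ⟨by omega, Or.inr (by omega)⟩
    refine ⟨by omega, ?_⟩
    rw [show ((j : ℤ) + -(k : ℤ)).toNat = j - k by omega]
    exact h1.2
  · have hg : taylor (k : K) g = ∏ j ∈ R, (X - C ((j : K) - k)) := by
      refine (map_prod (taylorAlgHom (k : K)) _ _).trans (Finset.prod_congr rfl fun j _ => ?_)
      change taylor (k : K) (X - C (j : K)) = _
      rw [map_sub, taylor_X, taylor_C, C_sub]
      ring
    rw [hg]
    -- Roots of `g` are admissible exponents; those of its translate are `j - k` with `j ∈ R`, which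
    -- by choice of `R` are not.
    refine IsCoprime.prod_left fun i hi => IsCoprime.prod_right fun j hj => ?_
    refine isCoprime_X_sub_C_of_isUnit_sub (IsUnit.mk0 _ fun h => ?_)
    have h1 : i + k = j := by
      have h2 : ((i + k : ℕ) : K) = (j : ℕ) := by
        push_cast
        linear_combination h
      exact_mod_cast h2
    refine (hR.mp hj).2.2 ⟨by omega, ?_⟩
    rw [← h1, Nat.add_sub_cancel]
    exact (hR.mp hi).2.1

variable {K : Type*} [Field K] [CharZero K] {m : ℕ}

/-- The operator `d` annihilates the image of `cuspFiltration K m r * u` modulo `J`. -/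
def Annihilates (J : Ideal (DiffOps K (cuspAlgebra K m))) (u : DiffOps K (cuspAlgebra K m))
    (r : ℕ) (d : DiffOps K (cuspAlgebra K m)) : Prop :=
  ∀ e ∈ cuspFiltration K m r, d * e * u ∈ J

namespace Annihilates

variable {J : Ideal (DiffOps K (cuspAlgebra K m))} {u d d' e : DiffOps K (cuspAlgebra K m)}
  {r s : ℕ}

theorem mono (h : Annihilates J u s d) (hrs : r ≤ s) : Annihilates J u r d :=
  fun e he => h e (cuspFiltration_mono hrs he)

theorem mul_left (h : Annihilates J u r d) (e : DiffOps K (cuspAlgebra K m)) :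
    Annihilates J u r (e * d) := fun f hf => by
  rw [mul_assoc, mul_assoc, ← mul_assoc d]
  exact J.mul_mem_left _ (h f hf)

/-- Right multiplication costs filtration degree, whereas left multiplication is free because `J` is
a left ideal. This accounts for the constants in `mem`. -/
theorem mul_right (h : Annihilates J u (r + s) d) (he : e ∈ cuspFiltration K m s) :
    Annihilates J u r (d * e) := fun f hf => by
  rw [mul_assoc d]
  exact h _ (by rw [add_comm]; exact cuspFiltration_mul_mem he hf)

theorem add (h : Annihilates J u r d) (h' : Annihilates J u r d') :
    Annihilates J u r (d + d') := fun f hf => by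
  rw [add_mul, add_mul]
  exact J.add_mem (h f hf) (h' f hf)

theorem sub (h : Annihilates J u r d) (h' : Annihilates J u r d') :
    Annihilates J u r (d - d') := fun f hf => by
  rw [sub_mul, sub_mul]
  exact J.sub_mem (h f hf) (h' f hf)

theorem smul (h : Annihilates J u r d) (c : K) : Annihilates J u r (c • d) := fun f hf => by
  rw [smul_mul_assoc, smul_mul_assoc]
  exact (J.restrictScalars K).smul_mem c (h f hf)

/-- The Euler operator acts on weight `l` by the commutator eigenvalue `l`; subtracting `t • d`
kills weight `t`, at the cost of one filtration degree. -/
theorem exists_component (s : Finset ℤ) {k : ℤ} (hks : k ∉ s)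
    (hs : ∀ l, symbol d l ≠ 0 → l = k ∨ l ∈ s) (h : Annihilates J u (r + s.card) d) :
    ∃ d', ∃ c : K, c ≠ 0 ∧ symbol d' = Pi.single k (c • symbol d k) ∧ Annihilates J u r d' := by
  induction s using Finset.induction_on generalizing d with
  | empty =>
    refine ⟨d, 1, one_ne_zero, funext fun l => ?_, h⟩
    rw [one_smul]
    rcases eq_or_ne l k with rfl | hl
    · rw [Pi.single_eq_same]
    · rw [Pi.single_eq_of_ne hl]
      by_contra h0
      exact hl (by simpa using hs l h0)
  | insert t s hts ih =>
    rw [Finset.card_insert_of_notMem hts, ← add_assoc] at h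
    let E : DiffOps K (cuspAlgebra K m) := weightOp X 0 (preservesCusp_zero X)
    have hE : E ∈ cuspFiltration K m 1 :=
      mem_cuspFiltration_of_single (symbol_weightOp _) (by simp) (by simp)
    have hsym : ∀ l, symbol (E * d - d * E - (t : K) • d) l = ((l - t : ℤ) : K) • symbol d l :=
      fun l => by
        simp only [E, map_sub, map_smul, Pi.sub_apply, Pi.smul_apply, symbol_euler_mul,
          symbol_mul_euler, smul_eq_C_mul, Int.cast_sub]
        ring
    obtain ⟨d', c, hc, hd', ha⟩ := ih (d := E * d - d * E - (t : K) • d)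
      (fun hk => hks (Finset.mem_insert_of_mem hk))
      (fun l hl => by
        rw [hsym] at hl
        rcases hs l fun h0 => hl (by rw [h0, smul_zero]) with h1 | h1
        · exact Or.inl h1
        · rcases Finset.mem_insert.mp h1 with rfl | h2
          · simp at hl
          · exact Or.inr h2)
      (((h.mono (Nat.le_succ _)).mul_left E |>.sub (h.mul_right hE)).sub
        ((h.mono (Nat.le_succ _)).smul _))
    refine ⟨d', c * ((k - t : ℤ) : K), mul_ne_zero hc ?_, ?_, ha⟩
    · rw [Int.cast_ne_zero, sub_ne_zero]
      rintro rfl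
      exact hks (Finset.mem_insert_self _ _)
    · rw [hd', hsym, mul_smul]

/-- Each commutator with `x ^ m` lowers the degree of `p`, keeps it nonzero until it is constant,
and costs `m`. -/
theorem exists_monomial (hm : 0 < m) {n k : ℕ} {p : K[X]} (hp0 : p ≠ 0) (hp : p.natDegree ≤ n)
    (hd : symbol d = Pi.single (k : ℤ) p) (h : Annihilates J u (r + n * m) d) :
    ∃ d', ∃ (c : K) (l : ℕ), c ≠ 0 ∧ k ≤ l ∧ l ≤ k + n * m ∧ symbol d' = Pi.single (l : ℤ) (C c) ∧
      Annihilates J u r d' := by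
  induction n generalizing d k p with
  | zero =>
    have hC := eq_C_of_natDegree_le_zero hp
    refine ⟨d, p.coeff 0, k, fun h0 => hp0 (by rw [hC, h0, C_0]), le_rfl, by omega, ?_, ?_⟩
    · rw [hd, ← hC]
    · simpa using h
  | succ n ih =>
    rcases Nat.eq_zero_or_pos p.natDegree with h0 | h0
    · have hC := eq_C_of_natDegree_eq_zero h0
      refine ⟨d, p.coeff 0, k, fun h0 => hp0 (by rw [hC, h0, C_0]), le_rfl, by omega, ?_,
        h.mono (by omega)⟩
      rw [hd, ← hC]
    · have hx := symbol_weightOp (preservesCusp_natCast (m := m) (1 : K[X]) (Or.inr le_rfl))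
      set x := weightOp (1 : K[X]) (m : ℤ) (preservesCusp_natCast 1 (Or.inr le_rfl))
      have hxm : x ∈ cuspFiltration K m m :=
        mem_cuspFiltration_of_single hx (by simp) (by simp)
      have hsym : symbol (d * x - x * d) =
          Pi.single ((k + m : ℕ) : ℤ) (taylor (m : K) p - p) := by
        rw [map_sub, symbol_mul_of_single hd hx, symbol_mul_of_single hx hd, taylor_one, C_1,
          one_mul, mul_one, add_comm (m : ℤ), ← Pi.single_sub, Nat.cast_add, Int.cast_natCast]
      rw [add_mul, one_mul, ← add_assoc] at h
      obtain ⟨d', c, l, hc, hkl, hlk, hd', ha⟩ := ih (taylor_sub_ne_zero h0 hm)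
        (natDegree_taylor_sub_le hp _) hsym
        ((h.mul_right hxm).sub ((h.mono (Nat.le_add_right _ _)).mul_left x))
      exact ⟨d', c, l, hc, by omega, by rw [add_mul]; omega, hd', ha⟩

/-- With `y` of weight `-k` and polynomial `g`, the products `d * y` and `y * d` have weight `0` and
polynomials `c g` and `c g(X + k)`; a Bézout relation between them yields `c • 1`. -/
theorem mem_of_monomial {k : ℕ} {c : K} (hc : c ≠ 0) (hd : symbol d = Pi.single (k : ℤ) (C c))
    (h : Annihilates J u (k + m) d) : u ∈ J := by
  obtain ⟨g, hg, hgk, a, b, hab⟩ := exists_preservesCusp_neg K m k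
  have hy := symbol_weightOp hgk
  set y := weightOp g _ hgk
  have hym : y ∈ cuspFiltration K m (k + m) := mem_cuspFiltration_of_single hy hg (by omega)
  let A : DiffOps K (cuspAlgebra K m) := weightOp a 0 (preservesCusp_zero a)
  let B : DiffOps K (cuspAlgebra K m) := weightOp b 0 (preservesCusp_zero b)
  have h1 : Annihilates J u 0 (A * (d * y) + B * (y * d)) :=
    (((h.mono (by omega)).mul_right hym).mul_left A).add
      (((h.mono (Nat.zero_le _)).mul_left y).mul_left B)
  have h2 : A * (d * y) + B * (y * d) = c • 1 := by
    refine symbol_injective ?_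
    rw [map_add, map_smul, symbol_one,
      symbol_mul_of_single (symbol_weightOp _) (symbol_mul_of_single hd hy),
      symbol_mul_of_single (symbol_weightOp _) (symbol_mul_of_single hy hd)]
    simp only [add_neg_cancel, neg_add_cancel, zero_add, Int.cast_zero, taylor_zero, taylor_C,
      Int.cast_natCast]
    rw [← Pi.single_add, ← Pi.single_smul, smul_eq_C_mul, ← hab]
    congr 1
    ring
  rw [h2] at h1
  have h3 := h1 1 (mem_cuspFiltration_of_single symbol_one (by simp) (by simp))
  rw [mul_one, smul_mul_assoc, one_mul] at h3
  have h4 := (J.restrictScalars K).smul_mem c⁻¹ h3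
  rwa [inv_smul_smul₀ hc] at h4

theorem mem (hm : 0 < m) {i : ℕ} (hd : d ∈ cuspFiltration K m i) (hd0 : d ≠ 0)
    (h : Annihilates J u ((2 * m + 4) * i + (2 * m + 1)) d) : u ∈ J := by
  obtain ⟨k, hk, -⟩ := exists_top_symbol hd0
  rw [mem_cuspFiltration] at hd
  have hki := (hd k).2 hk
  let s := (Finset.Icc (-(i : ℤ)) i).erase k
  have hs : s.card ≤ 2 * i + 1 := by
    refine (Finset.card_erase_le).trans ?_
    rw [Int.card_Icc]
    omega
  -- From the right: `2 * i + 1` to isolate a weight, `i * m` to reach a monomial, and its weight,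
  -- at most `2 * i + m + i * m`, plus `m` to reach `1`.
  have hN : (2 * m + 4) * i + (2 * m + 1) =
      ((2 * i + m + i * m + m) + i * m) + (2 * i + 1) := by ring
  obtain ⟨d₁, c, hc, hd₁, h₁⟩ := exists_component (d := d) s (Finset.notMem_erase _ _)
    (fun l hl => by
      have := (hd l).2 hl
      rcases eq_or_ne l k with hlk | hlk
      · exact Or.inl hlk
      · exact Or.inr (Finset.mem_erase.mpr ⟨hlk, Finset.mem_Icc.mpr (by omega)⟩))
    (h.mono (r := ((2 * i + m + i * m + m) + i * m) + s.card) (by omega))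
  -- Left multiplication by `x ^ (i + m)` makes the weight nonnegative.
  have hx := symbol_weightOp (preservesCusp_natCast (m := m) (1 : K[X]) (s := i + m)
    (Or.inr (by omega)))
  have hxd := symbol_mul_of_single hx hd₁
  obtain ⟨t, ht⟩ := Int.eq_ofNat_of_zero_le (show 0 ≤ ((i + m : ℕ) : ℤ) + k by omega)
  rw [ht, taylor_one, C_1, one_mul] at hxd
  obtain ⟨d₂, c₂, l, hc₂, -, hl, hd₂, h₂⟩ := exists_monomial hm (smul_ne_zero hc hk)
    ((natDegree_smul_le _ _).trans (hd k).1) hxd (h₁.mul_left _)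
  exact mem_of_monomial hc₂ hd₂ (h₂.mono (by omega))

end Annihilates

theorem isBernsteinFiltration_cuspFiltration (hm : 0 < m) :
    IsBernsteinFiltration (cuspFiltration K m) where
  mono := cuspFiltration_mono
  exhaustive d := (exists_symbol_bound d).imp fun _ h => mem_cuspFiltration.mpr h
  mul_mem := cuspFiltration_mul_mem
  finite := cuspFiltration_finite
  growth_le k := ⟨_, fun i => finrank_cuspFiltration_add_le i k⟩
  le_growth := ⟨m, sq_le_finrank_cuspFiltration⟩
  faithful := ⟨_, _, fun _ _ hd hd0 _ _ h => Annihilates.mem hm hd hd0 h⟩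

end Annihilators

theorem theorem2p8 (K : Type*) [Field K] [CharZero K] (m : ℕ) (hm : 2 ≤ m)
    (I : Ideal (DiffOps K (cuspAlgebra K m))) (hI : I ≠ ⊥) :
    IsFiniteLength (DiffOps K (cuspAlgebra K m)) (DiffOps K (cuspAlgebra K m) ⧸ I) := by
  exact (isBernsteinFiltration_cuspFiltration (by omega)).isFiniteLength_quotient hI
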